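/- **Definitions.** A parity automaton over an alphabet $\Pi$ with index $[\ell,h]$ ($\ell\le h$ natural numbers) has a set of states, a set of initial states, and transitions $(q,a,c,q')$ with $a\in\Pi$ and priority $c\in[\ell,h]$. It accepts an $\omega$-word $w\in\Pi^\omega$ if there is a run over $w$ from an initial state whose sequence of priorities has an even limit inferior. It is deterministic if it has exactly one initial state and for every state $q$ and letter $a$ there is exactly one pair $(c,q')$ such that $(q,a,c,q')$ is a transition. Let $(Q,\preceq)$ be a finite totally ordered set. For transitions in $Q\times\{0,1\}\times Q$ put $(p,c,q)\trianglelefteq(p',c',q')$ if $p\preceq p'$, $q'\preceq q$, and, in case $(p,q)=(p',q')$, $c\le c'$. An ordered Büchi automaton $\mathcal A=(Q,\preceq,I,\Gamma)$ consists of a downwards closed set $I\subseteq Q$ and a set $\Gamma$ of tiles, i.e. subsets of $Q\times\{0,1\}\times Q$, each upwards closed for $\trianglelefteq$. It is regarded as the parity automaton of index $[0,1]$ over the alphabet $\Gamma$ with initial states $I$ and with transitions $(p,t,c,q)$ for $t\in\Gamma$ and $(p,c,q)\in t$. Its language is denoted $L(\mathcal A)\subseteq\Gamma^\omega$. A record over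 $Q$ is a (possibly empty) tuple of pairwise distinct states whose entries form a downwards closed subset of $Q$ and whose first entry (if any) is the largest one. **Theorem.** There is a computable function which, given a finite description (lists of initial states and of transitions, with states, in increasing order, and letters numbered) of an ordered Büchi automaton $\mathcal A=(Q,\preceq,I,\Gamma)$, returns a finite description of a deterministic parity automaton $\mathcal D$ over $\Gamma$ such that 1. $L(\mathcal D)=L(\mathcal A)$; 2. $\mathcal D$ has at most $1+\sum_{i=0}^{|Q|-1} i!$ states; 3. the states of $\mathcal D$ are records over $Q$, and for every finite word $u\in\Gamma^*$ the entries of the record that $\mathcal D$ reaches after reading $u$ are exactly the states that $\mathcal A$ can reach from $I$ by reading $u$. -/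

import Mathlib

/-- A sequence of priorities is parity accepting (min-parity condition) if its limit inferior is
even. It is only applied to bounded sequences. -/
def ParityAccepting (c : ℕ → ℕ) : Prop :=
  Even (Filter.liminf c Filter.atTop)

/-- A (nondeterministic) parity automaton over the alphabet `Al` with set of states `Q`, with
priorities in the index `[lo, hi]`. A transition is a tuple (source, letter, priority, target). -/
structure ParityAutomaton (Al Q : Type*) where
  lo : ℕ
  hi : ℕ
  lo_le_hi : lo ≤ hi
  initial : Set Q
  trans : Set (Q × Al × ℕ × Q)
  priority_mem : ∀ d ∈ trans, lo ≤ d.2.2.1 ∧ d.2.2.1 ≤ hi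

namespace ParityAutomaton

/-- The `ω`-words over `Al` that admit an accepting run. -/
def language {Al Q : Type*} (A : ParityAutomaton Al Q) : Set (ℕ → Al) :=
  {w | ∃ (q : ℕ → Q) (c : ℕ → ℕ), q 0 ∈ A.initial ∧
    (∀ i, (q i, w i, c i, q (i + 1)) ∈ A.trans) ∧ ParityAccepting c}

/-- There is a single initial state, and the transition relation is the graph of a total function
from (state, letter) to (priority, state). -/
def IsDeterministic {Al Q : Type*} (A : ParityAutomaton Al Q) : Prop :=
  (∃ q, A.initial = {q}) ∧
    ∀ (q : Q) (a : Al), ∃! x : ℕ × Q, (q, a, x.1, x.2) ∈ A.trans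

/-- The states that can be reached from an initial state by reading the finite word `u`. -/
def reach {Al Q : Type*} (A : ParityAutomaton Al Q) (u : List Al) : Set Q :=
  u.foldl (fun X a => {q' | ∃ q ∈ X, ∃ c, (q, a, c, q') ∈ A.trans}) A.initial

end ParityAutomaton

/-- A Büchi tile over `Q`: a set of transitions `(p, c, q)`, where `c = 0` marks the Büchi
transitions. -/
abbrev Tile (Q : Type*) := Set (Q × Fin 2 × Q)

/-- The order on transitions induced by the order on states:
`(p, c, q)` is below `(p', c', q')` if `p ≤ p'`, `q' ≤ q`, and `c ≤ c'` in case
`(p, q) = (p', q')`. -/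
def TransLE {Q : Type*} [LinearOrder Q] (d d' : Q × Fin 2 × Q) : Prop :=
  d.1 ≤ d'.1 ∧ d'.2.2 ≤ d.2.2 ∧ ((d.1, d.2.2) = (d'.1, d'.2.2) → d.2.1 ≤ d'.2.1)

/-- The tile `t` is upwards closed for `TransLE`. -/
def Tile.IsUpClosed {Q : Type*} [LinearOrder Q] (t : Tile Q) : Prop :=
  ∀ d d' : Q × Fin 2 × Q, TransLE d d' → d ∈ t → d' ∈ t

/-- An ordered Büchi automaton on the totally ordered set of states `Q`. Its alphabet is the set
`tiles`, each letter being the set of transitions that it allows. -/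
structure OrderedBuchi (Q : Type*) [LinearOrder Q] where
  initial : Set Q
  tiles : Set (Tile Q)
  initial_lower : IsLowerSet initial
  tiles_upClosed : ∀ t ∈ tiles, Tile.IsUpClosed t

/-- The ordered Büchi automaton as a parity automaton with index `[0, 1]` over its alphabet of
tiles. -/
def OrderedBuchi.toParity {Q : Type*} [LinearOrder Q] (A : OrderedBuchi Q) :
    ParityAutomaton A.tiles Q where
  lo := 0
  hi := 1
  lo_le_hi := Nat.zero_le 1
  initial := A.initial
  trans := {d | ∃ c : Fin 2, d.2.2.1 = (c : ℕ) ∧ (d.1, c, d.2.2.2) ∈ (d.2.1 : Tile Q)}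
  priority_mem := by
    rintro d ⟨c, hc, -⟩
    have := c.isLt
    omega

/-- A record over `Q`: a (possibly empty) tuple of pairwise distinct states whose entries form a
downwards closed set, and whose first entry is the largest one. -/
structure Record (Q : Type*) [LinearOrder Q] where
  toList : List Q
  nodup : toList.Nodup
  lower : IsLowerSet {q | q ∈ toList}
  head_max : ∀ m ∈ toList.head?, ∀ q ∈ toList, q ≤ m

/-- Finite data that describe a finite parity automaton: numbers of letters and of states, the
bounds of the index, the list of initial states and the list of transitions
(source, letter, priority, target), states and letters being given by their numbers. -/
structure AutCode where
  numLetters : ℕ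
  numStates : ℕ
  lo : ℕ
  hi : ℕ
  initial : List ℕ
  trans : List (ℕ × ℕ × ℕ × ℕ)

/-- An automaton description as a tuple of its components. -/
def AutCode.equivProd :
    AutCode ≃ ℕ × ℕ × ℕ × ℕ × List ℕ × List (ℕ × ℕ × ℕ × ℕ) where
  toFun c := (c.numLetters, c.numStates, c.lo, c.hi, c.initial, c.trans)
  invFun x := ⟨x.1, x.2.1, x.2.2.1, x.2.2.2.1, x.2.2.2.2.1, x.2.2.2.2.2⟩
  left_inv _ := rfl
  right_inv _ := rfl

instance : Primcodable AutCode := Primcodable.ofEquiv _ AutCode.equivProd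

/-- The data `C` describe the automaton `A`, when its letters are numbered by `l` and its states
by `e`. -/
def AutCode.Describes (C : AutCode) {Al Q : Type*} {m n : ℕ} (A : ParityAutomaton Al Q)
    (l : Al ≃ Fin m) (e : Q ≃ Fin n) : Prop :=
  C.numLetters = m ∧ C.numStates = n ∧ C.lo = A.lo ∧ C.hi = A.hi ∧
    (∀ x : ℕ, x ∈ C.initial ↔ ∃ q ∈ A.initial, x = e q) ∧
    (∀ x : ℕ × ℕ × ℕ × ℕ, x ∈ C.trans ↔
      ∃ d ∈ A.trans, x = ((e d.1 : ℕ), (l d.2.1 : ℕ), d.2.2.1, (e d.2.2.2 : ℕ)))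

/-!
The deterministic automaton lists the reachable states in a record and lets every entry follow its
best move, the one with the largest target. Entries without a move disappear, entries that meet
merge into the leftmost of them, the entries behind close the gaps, and the remaining reachable
states, which lie below the first entry because tiles are upwards closed, are appended as new
entries. Reading a letter emits `2 * j + 2` if the leftmost event happens at position `j` and is a
Büchi transition, and `2 * j + 1` if it is a disappearance.

If the limit inferior of the priorities is `2 * j + 2`, the entry at position `j` eventually lives
forever and takes infinitely many Büchi transitions, and it extends backwards to an accepting run.

If the limit inferior is `2 * k + 1`, the first `k` positions eventually hold threads without Büchi
transitions, while infinitely often every entry behind them moves to the left. By upward closure, a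
run that is strictly below such a thread remains strictly below it, since it could reach the target
of the thread only if that best move of the thread were a Büchi transition. So the run `ρ`
eventually has the same threads above it at all times. The best moves from an entry in the window
between `ρ` and the next thread above stay in that window and keep moving to the left, until they
end up at one of the first `k` positions. There the entry is itself one of the threads, and it can
only be `ρ`.
From then on `ρ` agrees with this thread, so it is not accepting.
-/

open Filter

section Sequences

theorem eventually_liminf_le_and_frequently_eq_liminf {c : ℕ → ℕ} {b : ℕ} (hc : ∀ i, c i ≤ b) :
    (∀ᶠ i in atTop, liminf c atTop ≤ c i) ∧ ∃ᶠ i in atTop, c i = liminf c atTop := by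
  have hbdd : IsBoundedUnder (· ≥ ·) atTop c := isBoundedUnder_of ⟨0, fun _ => Nat.zero_le _⟩
  have hcobdd : IsCoboundedUnder (· ≥ ·) atTop c :=
    (isBoundedUnder_of ⟨b, hc⟩ : IsBoundedUnder (· ≤ ·) atTop c).isCoboundedUnder_ge
  have hge : ∀ᶠ i in atTop, liminf c atTop ≤ c i := by
    rcases Nat.eq_zero_or_pos (liminf c atTop) with h | h
    · exact Eventually.of_forall fun i => h ▸ Nat.zero_le _
    · exact (eventually_lt_of_lt_liminf (Nat.sub_lt h one_pos) hbdd).mono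
        fun i hi => Nat.le_of_pred_lt hi
  have hle : ∃ᶠ i in atTop, c i < liminf c atTop + 1 :=
    frequently_lt_of_liminf_lt hcobdd (Nat.lt_succ_self _)
  exact ⟨hge, (hle.and_eventually hge).mono fun i hi => (Nat.lt_succ_iff.mp hi.1).antisymm hi.2⟩

theorem parityAccepting_iff_frequently_eq_zero {c : ℕ → ℕ} (hc : ∀ i, c i ≤ 1) :
    ParityAccepting c ↔ ∃ᶠ i in atTop, c i = 0 := by
  obtain ⟨hge, heq⟩ := eventually_liminf_le_and_frequently_eq_liminf hc
  constructor
  · intro hacc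
    obtain ⟨i, hi⟩ := heq.exists
    have hzero : liminf c atTop = 0 := by
      have := hc i
      rw [ParityAccepting, Nat.even_iff] at hacc
      omega
    rwa [hzero] at heq
  · intro hzero
    obtain ⟨i, hi, hle⟩ := (hzero.and_eventually hge).exists
    rw [hi, Nat.le_zero] at hle
    rw [ParityAccepting, hle]
    exact Even.zero

theorem eventually_forall_iff_succ {ι : Type*} [Finite ι] {P : ι → ℕ → Prop}
    (hP : ∀ j, ∀ᶠ i in atTop, P j i → P j (i + 1)) :
    ∀ᶠ i in atTop, ∀ j, (P j i ↔ P j (i + 1)) := by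
  refine eventually_all.mpr fun j => ?_
  obtain ⟨N, hN⟩ := eventually_atTop.mp (hP j)
  by_cases hex : ∃ i ≥ N, P j i
  · obtain ⟨i, hi, hPi⟩ := hex
    have hstable : ∀ i' ≥ i, P j i' := fun i' hi' =>
      Nat.le_induction hPi (fun a ha => hN a (hi.trans ha)) i' hi'
    filter_upwards [eventually_ge_atTop i] with i' hi'
    exact iff_of_true (hstable i' hi') (hstable _ (hi'.trans (Nat.le_succ i')))
  · push Not at hex
    filter_upwards [eventually_ge_atTop N] with i hi
    exact iff_of_false (hex i hi) (hex _ (hi.trans (Nat.le_succ i)))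

theorem exists_of_frequently_descent {D : ℕ → ℕ → Prop} {k M : ℕ}
    (hstep : ∀ i ≥ M, ∀ d, D i d → D (i + 1) d)
    (hdescent : ∃ᶠ i in atTop, ∀ d ≥ k, D i (d + 1) → D (i + 1) d) {i d : ℕ} (hi : M ≤ i)
    (hd : k ≤ d) (h : D i d) : ∃ i' ≥ M, D i' k := by
  induction d, hd using Nat.le_induction generalizing i with
  | base => exact ⟨i, hi, h⟩
  | succ d hd ih =>
    obtain ⟨i', hi', hdrop⟩ := frequently_atTop.mp hdescent i
    have hDi' : D i' (d + 1) :=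
      Nat.le_induction h (fun a ha => hstep a (hi.trans ha) (d + 1)) i' hi'
    exact ih ((hi.trans hi').trans (Nat.le_succ i')) (hdrop d hd hDi')

theorem exists_run_extending {Q : Type*} {X : ℕ → Set Q} {R : ℕ → Q → Q → Prop}
    (hpred : ∀ i, ∀ q ∈ X (i + 1), ∃ p ∈ X i, R i p q) {N : ℕ} {σ : ℕ → Q} (hN : σ N ∈ X N)
    (hσ : ∀ i ≥ N, R i (σ i) (σ (i + 1))) :
    ∃ ρ : ℕ → Q, ρ 0 ∈ X 0 ∧ (∀ i, R i (ρ i) (ρ (i + 1))) ∧ ∀ i ≥ N, ρ i = σ i := by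
  induction N generalizing σ with
  | zero => exact ⟨σ, hN, fun i => hσ i (Nat.zero_le i), fun _ _ => rfl⟩
  | succ N ih =>
    obtain ⟨p, hp, hpq⟩ := hpred N _ hN
    have hne : ∀ i ≥ N + 1, Function.update σ N p i = σ i := fun i hi =>
      Function.update_of_ne (Nat.ne_of_gt hi) _ _
    obtain ⟨ρ, h0, hρ, heq⟩ := ih (σ := Function.update σ N p) (by simpa using hp) fun i hi => by
      rw [hne (i + 1) (Nat.succ_le_succ hi)]
      rcases hi.eq_or_lt with rfl | hi
      · simpa using hpq
      · rw [hne i hi]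
        exact hσ i hi
    exact ⟨ρ, h0, hρ, fun i hi => (heq i (Nat.le_of_succ_le hi)).trans (hne i hi)⟩

end Sequences

namespace Tile

section Moves

variable {Q : Type*} {t : Tile Q}

/-- The tile allows a transition from `p` to `q`, Büchi or not. -/
def Move (t : Tile Q) (p q : Q) : Prop :=
  ∃ c, (p, c, q) ∈ t

variable [LinearOrder Q]

/-- `q` is the largest state to which the tile allows a transition from `p`. -/
def IsBestMove (t : Tile Q) (p q : Q) : Prop :=
  IsGreatest {q | t.Move p q} q

theorem IsUpClosed.mem_of_ne (ht : t.IsUpClosed) {p p' q q' : Q} {c c' : Fin 2}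
    (hmem : (p, c, q) ∈ t) (hp : p ≤ p') (hq : q' ≤ q) (hne : (p, q) ≠ (p', q')) :
    (p', c', q') ∈ t :=
  ht _ _ ⟨hp, hq, fun h => absurd h hne⟩ hmem

theorem IsUpClosed.move_mono (ht : t.IsUpClosed) {p p' q q' : Q} (hmove : t.Move p q)
    (hp : p ≤ p') (hq : q' ≤ q) : t.Move p' q' :=
  hmove.imp fun c hmem => ht (p, c, q) (p', c, q') ⟨hp, hq, fun _ => le_rfl⟩ hmem

theorem IsBestMove.lt_of_lt (ht : t.IsUpClosed) {p p' q q' : Q} (hbest : t.IsBestMove p' q')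
    (hplain : (p', 0, q') ∉ t) (hlt : p < p') (hmove : t.Move p q) : q < q' := by
  have hle : q ≤ q' := hbest.2 (ht.move_mono hmove hlt.le le_rfl)
  refine hle.lt_of_ne ?_
  rintro rfl
  obtain ⟨c, hmem⟩ := hmove
  exact hplain (ht.mem_of_ne hmem hlt.le le_rfl fun h => hlt.ne (Prod.mk.inj h).1)

end Moves

/-- What one letter does to a record: reading the tile `t` turns the record `r` into `r'` and emits
the priority `c`. Entries follow their best moves and never drift to the right. With priority
`2 * k + 1`, the first `k` entries keep their positions, and all entries behind them move to the
left; with priority `2 * j + 2` the entry at position `j`, counted from `0`, is the leftmost one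
to take a Büchi transition, and it keeps its position. -/
structure RecordStep {Q : Type*} [LinearOrder Q] (t : Tile Q) (r r' : List Q) (c : ℕ) :
    Prop where
  mem_iff : ∀ q, q ∈ r' ↔ ∃ p ∈ r, t.Move p q
  mem_take : ∀ j p q, p ∈ r.take j → t.IsBestMove p q → q ∈ r'.take j
  mem_take_of_odd : ∀ k j p q, c = 2 * k + 1 → k ≤ j → p ∈ r.take (j + 1) → t.IsBestMove p q →
    q ∈ r'.take j
  getElem?_of_le : ∀ j, 2 * j + 2 ≤ c → ∃ p q, r[j]? = some p ∧ r'[j]? = some q ∧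
    t.IsBestMove p q ∧ ((p, 0, q) ∈ t ↔ c = 2 * j + 2)
  pos : 0 < c

/-- `ρ` is a run over the sequence of tiles `t` that starts in `X` and takes infinitely often a
move which could be a Büchi transition. -/
def IsBuchiRun {Q : Type*} (t : ℕ → Tile Q) (X : Set Q) (ρ : ℕ → Q) : Prop :=
  ρ 0 ∈ X ∧ (∀ i, (t i).Move (ρ i) (ρ (i + 1))) ∧
    ∃ᶠ i in atTop, (ρ i, 0, ρ (i + 1)) ∈ t i

/-- From time `N` on, `θ` always takes its best move, and this is never a Büchi transition. -/
def IsPlainThread {Q : Type*} [LinearOrder Q] (t : ℕ → Tile Q) (N : ℕ) (θ : ℕ → Q) : Prop :=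
  ∀ i ≥ N, (t i).IsBestMove (θ i) (θ (i + 1)) ∧ (θ i, 0, θ (i + 1)) ∉ t i

section RecordRuns

variable {Q : Type*} [LinearOrder Q]

theorem RecordStep.exists_isBestMove {t : Tile Q} {r r' : List Q} {c : ℕ}
    (hstep : t.RecordStep r r' c) {p q : Q} (hp : p ∈ r) (hmove : t.Move p q) :
    ∃ q', t.IsBestMove p q' := by
  have hfin : {q | t.Move p q}.Finite :=
    r'.finite_toSet.subset fun q' hq' => (hstep.mem_iff q').mpr ⟨p, hp, hq'⟩
  exact (Set.exists_max_image _ id hfin ⟨q, hmove⟩).imp fun _ h => ⟨h.1, fun _ hq' => h.2 _ hq'⟩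

variable {t : ℕ → Tile Q} {r : ℕ → List Q} {c : ℕ → ℕ} {N : ℕ}

theorem exists_thread (hstep : ∀ i, (t i).RecordStep (r i) (r (i + 1)) (c i)) {j : ℕ}
    (hj : ∀ i ≥ N, 2 * j + 2 ≤ c i) :
    ∃ θ : ℕ → Q, ∀ i ≥ N, (r i)[j]? = some (θ i) ∧ (t i).IsBestMove (θ i) (θ (i + 1)) ∧
      ((θ i, 0, θ (i + 1)) ∈ t i ↔ c i = 2 * j + 2) := by
  have hentry : ∀ i ≥ N, ∃ p, (r i)[j]? = some p := fun i hi =>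
    let ⟨p, _, hp, _⟩ := (hstep i).getElem?_of_le j (hj i hi)
    ⟨p, hp⟩
  have : Nonempty Q := ⟨(hentry N le_rfl).choose⟩
  choose! θ hθ using hentry
  refine ⟨θ, fun i hi => ?_⟩
  obtain ⟨p, q, hp, hq, hmove⟩ := (hstep i).getElem?_of_le j (hj i hi)
  obtain rfl : θ i = p := Option.some.inj ((hθ i hi).symm.trans hp)
  obtain rfl : θ (i + 1) = q :=
    Option.some.inj ((hθ (i + 1) (Nat.le_succ_of_le hi)).symm.trans hq)
  exact ⟨hp, hmove⟩

theorem exists_isBuchiRun_of_even (hstep : ∀ i, (t i).RecordStep (r i) (r (i + 1)) (c i)) {j : ℕ}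
    (hge : ∀ᶠ i in atTop, 2 * j + 2 ≤ c i) (heq : ∃ᶠ i in atTop, c i = 2 * j + 2) :
    ∃ ρ, IsBuchiRun t {q | q ∈ r 0} ρ := by
  obtain ⟨N, hN⟩ := eventually_atTop.mp hge
  obtain ⟨θ, hθ⟩ := exists_thread hstep hN
  obtain ⟨ρ, h0, hmove, hρ⟩ := exists_run_extending (X := fun i => {q | q ∈ r i})
    (fun i q => ((hstep i).mem_iff q).mp) (List.mem_of_getElem? (hθ N le_rfl).1)
    fun i hi => (hθ i hi).2.1.1
  refine ⟨ρ, h0, hmove, (heq.and_eventually (eventually_ge_atTop N)).mono ?_⟩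
  rintro i ⟨hc, hi⟩
  rw [hρ i hi, hρ (i + 1) (Nat.le_succ_of_le hi)]
  exact (hθ i hi).2.2.mpr hc

/-- The states that `ρ` cannot be told apart from, at time `i`, by the threads above it. -/
def window {ι : Type*} (θ : ι → ℕ → Q) (ρ : ℕ → Q) (i : ℕ) : Set Q :=
  {p | ρ i ≤ p ∧ ∀ j, ρ i < θ j i → p < θ j i}

theorem mem_window_of_isBestMove {ι : Type*} {θ : ι → ℕ → Q} {ρ : ℕ → Q} {i : ℕ}
    (ht : (t i).IsUpClosed) (hθ : ∀ j, IsPlainThread t N (θ j)) (hi : N ≤ i)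
    (hρ : (t i).Move (ρ i) (ρ (i + 1))) (hstable : ∀ j, ρ i < θ j i ↔ ρ (i + 1) < θ j (i + 1))
    {p q : Q} (hp : p ∈ window θ ρ i) (hbest : (t i).IsBestMove p q) :
    q ∈ window θ ρ (i + 1) :=
  ⟨hbest.2 (ht.move_mono hρ hp.1 le_rfl), fun j hj =>
    (hθ j i hi).1.lt_of_lt ht (hθ j i hi).2 (hp.2 j ((hstable j).mpr hj)) hbest.1⟩

theorem IsPlainThread.not_frequently_mem {θ ρ : ℕ → Q} {i : ℕ} (hθ : IsPlainThread t N θ)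
    (hρ : ∀ i, (t i).Move (ρ i) (ρ (i + 1))) {M : ℕ} (hNM : N ≤ M)
    (hstable : ∀ i ≥ M, (ρ i < θ i ↔ ρ (i + 1) < θ (i + 1))) (hi : M ≤ i) (heq : ρ i = θ i) :
    ¬ ∃ᶠ i in atTop, (ρ i, 0, ρ (i + 1)) ∈ t i := by
  have hforever : ∀ i' ≥ i, ρ i' = θ i' := fun i' hi' => by
    induction i', hi' using Nat.le_induction with
    | base => exact heq
    | succ a ha ih =>
      have haM : M ≤ a := hi.trans ha
      have hle : ρ (a + 1) ≤ θ (a + 1) := (hθ a (hNM.trans haM)).1.2 (ih ▸ hρ a)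
      exact hle.eq_of_not_lt fun hlt => ih.not_lt ((hstable a haM).mpr hlt)
  refine not_frequently.mpr ((eventually_ge_atTop i).mono fun i' hi' => ?_)
  rw [hforever i' hi', hforever (i' + 1) (Nat.le_succ_of_le hi')]
  exact (hθ i' (hNM.trans (hi.trans hi'))).2

theorem exists_eq_thread (ht : ∀ i, (t i).IsUpClosed)
    (hstep : ∀ i, (t i).RecordStep (r i) (r (i + 1)) (c i)) {k : ℕ}
    (heq : ∃ᶠ i in atTop, c i = 2 * k + 1) {θ : Fin k → ℕ → Q}
    (hpos : ∀ j : Fin k, ∀ i ≥ N, (r i)[(j : ℕ)]? = some (θ j i))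
    (hθ : ∀ j, IsPlainThread t N (θ j)) {ρ : ℕ → Q} (h0 : ρ 0 ∈ r 0)
    (hρ : ∀ i, (t i).Move (ρ i) (ρ (i + 1))) {M : ℕ} (hNM : N ≤ M)
    (hstable : ∀ i ≥ M, ∀ j, (ρ i < θ j i ↔ ρ (i + 1) < θ j (i + 1))) :
    ∃ i ≥ M, ∃ j, ρ i = θ j i := by
  have hmem : ∀ i, ρ i ∈ r i := fun i => by
    induction i with
    | zero => exact h0
    | succ i ih => exact ((hstep i).mem_iff _).mpr ⟨_, ih, hρ i⟩
  have hnext : ∀ i ≥ M, ∀ p ∈ window θ ρ i, p ∈ r i →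
      ∃ q ∈ window θ ρ (i + 1), (t i).IsBestMove p q := by
    intro i hi p hp hpr
    obtain ⟨q, hbest⟩ := (hstep i).exists_isBestMove hpr ((ht i).move_mono (hρ i) hp.1 le_rfl)
    exact ⟨q, mem_window_of_isBestMove (ht i) hθ (hNM.trans hi) (hρ i) (hstable i hi) hp hbest,
      hbest⟩
  obtain ⟨i, hi, p, hp, hpk⟩ : ∃ i ≥ M, ∃ p ∈ window θ ρ i, p ∈ (r i).take k := by
    refine exists_of_frequently_descent (D := fun i d => ∃ p ∈ window θ ρ i, p ∈ (r i).take d)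
      ?_ ?_ le_rfl (le_max_left k (r M).length) ⟨ρ M, ⟨le_rfl, fun _ => id⟩, ?_⟩
    · rintro i hi d ⟨p, hp, hpd⟩
      obtain ⟨q, hq, hbest⟩ := hnext i hi p hp (List.mem_of_mem_take hpd)
      exact ⟨q, hq, (hstep i).mem_take d p q hpd hbest⟩
    · refine (heq.and_eventually (eventually_ge_atTop M)).mono ?_
      rintro i ⟨hc, hi⟩ d hd ⟨p, hp, hpd⟩
      obtain ⟨q, hq, hbest⟩ := hnext i hi p hp (List.mem_of_mem_take hpd)
      exact ⟨q, hq, (hstep i).mem_take_of_odd k d p q hc hd hpd hbest⟩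
    · rw [List.take_of_length_le (le_max_right _ _)]
      exact hmem M
  obtain ⟨j, hj, hjp⟩ := List.mem_take_iff_getElem.mp hpk
  obtain ⟨hjk, hjr⟩ := lt_min_iff.mp hj
  have hpθ : p = θ ⟨j, hjk⟩ i := by
    rw [← Option.some_inj, ← hpos ⟨j, hjk⟩ i (hNM.trans hi), List.getElem?_eq_getElem hjr, hjp]
  refine ⟨i, hi, ⟨j, hjk⟩, (hpθ ▸ hp.1).eq_of_not_lt fun hlt => ?_⟩
  exact (hp.2 _ hlt).ne hpθ

theorem not_isBuchiRun_of_odd (ht : ∀ i, (t i).IsUpClosed)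
    (hstep : ∀ i, (t i).RecordStep (r i) (r (i + 1)) (c i)) {k : ℕ}
    (hge : ∀ᶠ i in atTop, 2 * k + 1 ≤ c i) (heq : ∃ᶠ i in atTop, c i = 2 * k + 1) (ρ : ℕ → Q) :
    ¬ IsBuchiRun t {q | q ∈ r 0} ρ := by
  rintro ⟨h0, hρ, hbuchi⟩
  obtain ⟨N, hN⟩ := eventually_atTop.mp hge
  have hlow : ∀ (j : Fin k) i, N ≤ i → 2 * (j : ℕ) + 2 < c i := fun j i hi => by
    have := hN i hi
    omega
  choose θ hθ using fun j : Fin k => exists_thread hstep fun i hi => (hlow j i hi).le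
  have hplain : ∀ j, IsPlainThread t N (θ j) := fun j i hi =>
    ⟨(hθ j i hi).2.1, fun hmem => (hlow j i hi).ne' ((hθ j i hi).2.2.mp hmem)⟩
  have hbelow : ∀ j, ∀ᶠ i in atTop, ρ i < θ j i → ρ (i + 1) < θ j (i + 1) := fun j =>
    (eventually_ge_atTop N).mono fun i hi hlt =>
      (hplain j i hi).1.lt_of_lt (ht i) (hplain j i hi).2 hlt (hρ i)
  obtain ⟨M, hM⟩ := eventually_atTop.mp
    ((eventually_forall_iff_succ hbelow).and (eventually_ge_atTop N))
  obtain ⟨i, hi, j, hij⟩ := exists_eq_thread ht hstep heq (fun j i hi => (hθ j i hi).1) hplain h0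
    hρ (hM M le_rfl).2 fun i hi => (hM i hi).1
  exact (hplain j).not_frequently_mem hρ (hM M le_rfl).2 (fun i hi => (hM i hi).1 j) hi hij hbuchi

theorem parityAccepting_iff_exists_isBuchiRun (ht : ∀ i, (t i).IsUpClosed)
    (hstep : ∀ i, (t i).RecordStep (r i) (r (i + 1)) (c i)) {b : ℕ} (hc : ∀ i, c i ≤ b) :
    ParityAccepting c ↔ ∃ ρ, IsBuchiRun t {q | q ∈ r 0} ρ := by
  obtain ⟨hge, heq⟩ := eventually_liminf_le_and_frequently_eq_liminf hc
  obtain ⟨i, hi⟩ := heq.exists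
  have hpos : 0 < liminf c atTop := hi ▸ (hstep i).pos
  rw [ParityAccepting]
  rcases Nat.even_or_odd' (liminf c atTop) with ⟨j, hj | hk⟩
  · obtain ⟨j, rfl⟩ := Nat.exists_eq_succ_of_ne_zero (show j ≠ 0 by omega)
    rw [hj] at hge heq
    exact iff_of_true ⟨j + 1, by omega⟩ (exists_isBuchiRun_of_even hstep hge heq)
  · rw [hk] at hge heq
    refine iff_of_false (by rw [hk]; exact Nat.not_even_two_mul_add_one j) ?_
    rintro ⟨ρ, hρ⟩
    exact not_isBuchiRun_of_odd ht hstep hge heq ρ hρ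

end RecordRuns

end Tile

section Survivors

variable {Q : Type*} [DecidableEq Q] (best : Q → Option Q) (g : Q → Bool)

/-- The images of the entries of `r` under `best`, in order: entries without an image disappear, and
so does an entry whose image is already that of an entry further to the left. -/
def survivors (r : List Q) : List Q :=
  (r.filterMap best).eraseDups

theorem mem_survivors_iff {r : List Q} {q : Q} :
    q ∈ survivors best r ↔ ∃ p ∈ r, best p = some q := by
  rw [survivors, List.mem_eraseDups, List.mem_filterMap]

theorem survivors_append_singleton (r : List Q) (p : Q) :
    survivors best (r ++ [p]) =
      survivors best r ++ (best p).toList.filter (· ∉ survivors best r) := by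
  rw [survivors, List.filterMap_append, List.eraseDups_append, ← survivors]
  congr 1
  rcases hp : best p with _ | q
  · simp [hp, List.removeAll]
  · by_cases hq : q ∈ survivors best r <;>
      simp_all [survivors, List.removeAll, List.eraseDups_cons]

theorem nodup_survivors (r : List Q) : (survivors best r).Nodup := by
  induction r using List.reverseRecOn with
  | nil => exact List.nodup_nil
  | append_singleton r p ih =>
    rw [survivors_append_singleton]
    refine ih.append (List.Nodup.filter _ ?_) fun q hq hq' => ?_
    · cases best p <;> simp
    · exact of_decide_eq_true (List.mem_filter.mp hq').2 hq

theorem survivors_prefix_append (r s : List Q) : survivors best r <+: survivors best (r ++ s) := by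
  rw [survivors, survivors, List.filterMap_append, List.eraseDups_append]
  exact List.prefix_append _ _

theorem length_survivors_append_le (r s : List Q) :
    (survivors best (r ++ s)).length ≤ (survivors best r).length + s.length := by
  induction s using List.reverseRecOn with
  | nil => simp
  | append_singleton s p ih =>
    have hle := (List.length_filter_le (· ∉ survivors best (r ++ s)) (best p).toList).trans
      Option.length_toList_le
    rw [← List.append_assoc, survivors_append_singleton, List.length_append, List.length_append,
      List.length_singleton]
    omega

theorem length_survivors_le (r : List Q) : (survivors best r).length ≤ r.length :=
  (length_survivors_append_le best [] r).trans_eq (Nat.zero_add _)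

theorem survivors_take_prefix (r : List Q) (j : ℕ) :
    survivors best (r.take j) <+: survivors best r := by
  conv_rhs => rw [← List.take_append_drop j r]
  exact survivors_prefix_append best _ _

/-- The number of entries of `r` that survive at their positions: the largest `k` such that none of
the first `k` entries disappears. -/
def numStable (r : List Q) : ℕ :=
  Nat.findGreatest (fun k => (survivors best (r.take k)).length = k) r.length

theorem numStable_le_length (r : List Q) : numStable best r ≤ r.length :=
  Nat.findGreatest_le _

theorem length_survivors_take_of_le {r : List Q} {j : ℕ} (hj : j ≤ numStable best r) :
    (survivors best (r.take j)).length = j := by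
  have hstable : (survivors best (r.take (numStable best r))).length = numStable best r :=
    Nat.findGreatest_spec (P := fun k => (survivors best (r.take k)).length = k)
      (Nat.zero_le _) rfl
  obtain ⟨d, hd⟩ := Nat.exists_eq_add_of_le hj
  rw [hd, List.take_add] at hstable
  have hsplit := length_survivors_append_le best (r.take j) ((r.drop j).take d)
  have hle := length_survivors_le best (r.take j)
  have hj' := List.length_take_le j r
  have hd' := List.length_take_le d (r.drop j)
  omega

theorem length_survivors_take_succ_le {r : List Q} {j : ℕ} (hj : numStable best r ≤ j) :
    (survivors best (r.take (j + 1))).length ≤ j := by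
  have hle := (length_survivors_le best (r.take (j + 1))).trans_eq List.length_take
  by_cases hlen : j + 1 ≤ r.length
  · have hne := Nat.findGreatest_is_greatest (Nat.lt_succ_of_le hj) hlen
    exact Nat.le_of_lt_succ ((hle.trans (min_le_left _ _)).lt_of_ne hne)
  · exact (hle.trans (min_le_right _ _)).trans (Nat.le_of_lt_succ (not_le.mp hlen))

theorem exists_getElem?_survivors {r : List Q} {j : ℕ} (hj : j < numStable best r) :
    ∃ p q, r[j]? = some p ∧ (survivors best r)[j]? = some q ∧ best p = some q := by
  have hlen : j < r.length := hj.trans_le (numStable_le_length best r)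
  have hsucc := length_survivors_take_of_le best (j := j + 1) hj
  have hpre := survivors_take_prefix best r (j + 1)
  have hlenj := length_survivors_take_of_le best hj.le
  rw [List.take_succ_eq_append_getElem hlen, survivors_append_singleton] at hsucc hpre
  rw [List.length_append, hlenj, Nat.add_left_cancel_iff] at hsucc
  obtain ⟨q, hq⟩ := List.length_eq_one_iff.mp hsucc
  rw [hq] at hpre
  have hbest : q ∈ (best r[j]).toList := List.mem_of_mem_filter (hq ▸ List.mem_singleton_self q)
  refine ⟨r[j], q, List.getElem?_eq_getElem hlen, ?_, Option.mem_toList.mp hbest⟩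
  rw [List.prefix_iff_getElem?.mp hpre j (by simp [hlenj]), List.getElem_append_right hlenj.le]
  simp [hlenj]

/-- The priority of the step of the record `r`: it counts the entries before the first one to
disappear (odd) or to take a Büchi transition (even), whichever comes first. -/
def stepPriority (r : List Q) : ℕ :=
  min (2 * numStable best r + 1) (2 * r.findIdx g + 2)

theorem stepPriority_le (r : List Q) : stepPriority best g r ≤ 2 * r.length + 1 :=
  (min_le_left _ _).trans (by have := numStable_le_length best r; omega)

end Survivors

theorem apply_iff_findIdx_eq {α : Type*} {g : α → Bool} {r : List α} {j : ℕ} {p : α}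
    (hp : r[j]? = some p) (hj : j ≤ r.findIdx g) : g p ↔ r.findIdx g = j := by
  refine ⟨fun hg => hj.antisymm' (not_lt.mp fun hlt => ?_), fun heq =>
    List.findIdx_of_getElem?_eq_some (heq ▸ hp)⟩
  obtain ⟨_, rfl⟩ := List.getElem?_eq_some_iff.mp hp
  exact Bool.eq_false_iff.mp (List.not_of_lt_findIdx hlt) hg

namespace Tile

section RecordStep

variable {Q : Type*} [LinearOrder Q] {t : Tile Q} {best : Q → Option Q} {g : Q → Bool}

/-- `best` and `g` tabulate the tile `t`: `best p` is the best move from `p`, if `p` has a move at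
all, and `g p` tells whether this move is a Büchi transition. -/
structure IsTabulatedBy (t : Tile Q) (best : Q → Option Q) (g : Q → Bool) : Prop where
  move_iff : ∀ p q, t.Move p q ↔ ∃ q', best p = some q' ∧ q ≤ q'
  buchi_iff : ∀ p q, best p = some q → (g p ↔ (p, 0, q) ∈ t)

theorem IsTabulatedBy.isBestMove_iff (h : t.IsTabulatedBy best g) {p q : Q} :
    t.IsBestMove p q ↔ best p = some q := by
  constructor
  · intro hbest
    obtain ⟨q', hq', hle⟩ := (h.move_iff p q).mp hbest.1
    rwa [hle.antisymm (hbest.2 ((h.move_iff p q').mpr ⟨q', hq', le_rfl⟩))]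
  · intro hq
    refine ⟨(h.move_iff p q).mpr ⟨q, hq, le_rfl⟩, fun q' hq' => ?_⟩
    obtain ⟨q'', hq'', hle⟩ := (h.move_iff p q').mp hq'
    rwa [Option.some.inj (hq.symm.trans hq'')]

theorem IsTabulatedBy.recordStep (h : t.IsTabulatedBy best g) {r r' : List Q}
    (hprefix : survivors best r <+: r') (hmem : ∀ q, q ∈ r' ↔ ∃ p ∈ r, t.Move p q) :
    t.RecordStep r r' (stepPriority best g r) := by
  have htake : ∀ {i j p q}, p ∈ r.take i → (survivors best (r.take i)).length ≤ j →
      t.IsBestMove p q → q ∈ r'.take j := fun {i j p q} hp hle hbest =>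
    (List.prefix_take_iff.mpr ⟨(survivors_take_prefix best r i).trans hprefix, hle⟩).subset
      ((mem_survivors_iff best).mpr ⟨p, hp, h.isBestMove_iff.mp hbest⟩)
  refine ⟨hmem, fun j p q hp => ?_, fun k j p q hc hkj hp => ?_, fun j hj => ?_, ?_⟩
  · exact htake hp ((length_survivors_le best _).trans (List.length_take_le _ _))
  · have hk : numStable best r = k := by rw [stepPriority] at hc; omega
    exact htake hp (length_survivors_take_succ_le best (hk ▸ hkj))
  · obtain ⟨hjk, hjg⟩ : j < numStable best r ∧ j ≤ r.findIdx g := by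
      rw [stepPriority] at hj; omega
    obtain ⟨p, q, hp, hq, hbest⟩ := exists_getElem?_survivors best hjk
    obtain ⟨hjlen, rfl⟩ := List.getElem?_eq_some_iff.mp hq
    have hgp : g p ↔ r.findIdx g = j := apply_iff_findIdx_eq hp hjg
    refine ⟨p, _, hp, List.prefix_iff_getElem?.mp hprefix j hjlen, h.isBestMove_iff.mpr hbest, ?_⟩
    rw [← h.buchi_iff p _ hbest, hgp, stepPriority]
    omega
  · rw [stepPriority]
    omega

end RecordStep

end Tile

/-- The condition on a list to be a record. The construction works with bare lists of numbers, as a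
computable function on descriptions has to. -/
structure IsRecord {Q : Type*} [LinearOrder Q] (r : List Q) : Prop where
  nodup : r.Nodup
  lower : IsLowerSet {q | q ∈ r}
  head_max : ∀ m ∈ r.head?, ∀ q ∈ r, q ≤ m

section NextRecord

/-- Appends to `s` the missing numbers below its first entry, in decreasing order. -/
def fillBelow (s : List ℕ) : List ℕ :=
  s ++ (List.range s.headI).reverse.filter (· ∉ s)

theorem prefix_fillBelow (s : List ℕ) : s <+: fillBelow s :=
  List.prefix_append _ _

theorem mem_fillBelow_iff {s : List ℕ} (hs : ∀ m ∈ s.head?, ∀ x ∈ s, x ≤ m) {x : ℕ} :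
    x ∈ fillBelow s ↔ ∃ y ∈ s, x ≤ y := by
  rcases s with _ | ⟨a, s⟩
  · simp [fillBelow]
  · have ha : ∀ y ∈ a :: s, y ≤ a := hs a rfl
    simp only [fillBelow, List.headI_cons, List.mem_append, List.mem_filter, List.mem_reverse,
      List.mem_range, decide_eq_true_eq]
    constructor
    · rintro (hx | ⟨hx, -⟩)
      · exact ⟨x, hx, le_rfl⟩
      · exact ⟨a, List.mem_cons_self, hx.le⟩
    · rintro ⟨y, hy, hxy⟩
      by_cases hx : x ∈ a :: s
      · exact Or.inl hx
      · exact Or.inr ⟨(hxy.trans (ha y hy)).lt_of_ne fun h => hx (h ▸ List.mem_cons_self), hx⟩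

theorem isRecord_fillBelow {s : List ℕ} (hnodup : s.Nodup)
    (hs : ∀ m ∈ s.head?, ∀ x ∈ s, x ≤ m) : IsRecord (fillBelow s) := by
  refine ⟨hnodup.append ((List.nodup_reverse.mpr List.nodup_range).filter _) ?_, ?_, ?_⟩
  · exact fun x hx hx' => of_decide_eq_true (List.mem_filter.mp hx').2 hx
  · intro x x' hle hx
    obtain ⟨y, hy, hxy⟩ := (mem_fillBelow_iff hs).mp hx
    exact (mem_fillBelow_iff hs).mpr ⟨y, hy, hle.trans hxy⟩
  · intro m hm x hx
    obtain ⟨y, hy, hxy⟩ := (mem_fillBelow_iff hs).mp hx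
    rcases s with _ | ⟨a, s⟩
    · simp at hy
    · exact hxy.trans (hs m hm y hy)

/-- The record after a letter whose best moves are given by `best`: the states that are reached
without being a best move of any entry are appended as new entries. -/
def nextRecord (best : ℕ → Option ℕ) (r : List ℕ) : List ℕ :=
  fillBelow (survivors best r)

namespace Tile

variable {t : Tile ℕ} {best : ℕ → Option ℕ} {g : ℕ → Bool}

theorem IsTabulatedBy.survivors_head_max (h : t.IsTabulatedBy best g) (ht : t.IsUpClosed)
    {r : List ℕ} (hr : ∀ m ∈ r.head?, ∀ p ∈ r, p ≤ m) :
    ∀ m ∈ (survivors best r).head?, ∀ q ∈ survivors best r, q ≤ m := by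
  intro m hm q hq
  obtain ⟨p, hp, hpq⟩ := (mem_survivors_iff best).mp hq
  rcases r with _ | ⟨a, r⟩
  · simp at hp
  · have hmove : t.Move a q :=
      ht.move_mono ((h.move_iff p q).mpr ⟨q, hpq, le_rfl⟩) (hr a rfl p hp) le_rfl
    obtain ⟨q', hq', hle⟩ := (h.move_iff a q).mp hmove
    obtain ⟨s, hs⟩ := survivors_prefix_append best [a] r
    have hhead : survivors best [a] = [q'] := by simp [survivors, hq', List.eraseDups_cons]
    rw [← List.singleton_append, ← hs, hhead] at hm
    exact hle.trans_eq (Option.some.inj hm)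

theorem IsTabulatedBy.recordStep_nextRecord (h : t.IsTabulatedBy best g) (ht : t.IsUpClosed)
    {r : List ℕ} (hr : IsRecord r) :
    t.RecordStep r (nextRecord best r) (stepPriority best g r) := by
  refine h.recordStep (prefix_fillBelow _) fun q => ?_
  rw [nextRecord, mem_fillBelow_iff (h.survivors_head_max ht hr.head_max)]
  simp only [mem_survivors_iff, h.move_iff]
  tauto

theorem IsTabulatedBy.isRecord_nextRecord (h : t.IsTabulatedBy best g) (ht : t.IsUpClosed)
    {r : List ℕ} (hr : IsRecord r) : IsRecord (nextRecord best r) :=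
  isRecord_fillBelow (nodup_survivors best r) (h.survivors_head_max ht hr.head_max)

end Tile

end NextRecord

namespace AutCode

section Tiles

variable (C : AutCode) (a : ℕ)

/-- The tile of the letter `a`, closed upwards among all natural numbers, so that the construction
needs no assumption on `C`. -/
def tile : Tile ℕ :=
  {x | ∃ d ∈ C.trans, d.2.1 = a ∧ d.1 ≤ x.1 ∧ x.2.2 ≤ d.2.2.2 ∧
    (d.1 = x.1 → d.2.2.2 = x.2.2 → x.2.1 = 0 → d.2.2.1 = 0)}

/-- The largest target of a transition with letter `a` whose source is at most `p`. -/
def bestTarget (p : ℕ) : Option ℕ :=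
  ((C.trans.filter fun d => d.2.1 = a ∧ d.1 ≤ p).map fun d => d.2.2.2).max?

/-- The move from `p` to `C.bestTarget a p` is a Büchi transition. -/
def isBuchi (p : ℕ) : Bool :=
  decide (∃ d ∈ C.trans, d.2.1 = a ∧ d.1 ≤ p ∧ C.bestTarget a p = some d.2.2.2 ∧
    (d.1 = p → d.2.2.1 = 0))

theorem isUpClosed_tile : (C.tile a).IsUpClosed := by
  rintro ⟨p, c, q⟩ ⟨p', c', q'⟩ ⟨hp, hq, hc⟩ ⟨d, hd, ha, hdp, hdq, hd0⟩
  dsimp only at hp hq hc hdp hdq hd0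
  refine ⟨d, hd, ha, hdp.trans hp, hq.trans hdq, ?_⟩
  rintro h1 h2 rfl
  dsimp only at h1 h2
  obtain rfl : p = p' := by omega
  obtain rfl : q = q' := by omega
  exact hd0 h1 h2 (Fin.le_zero_iff.mp (hc rfl))

theorem move_tile_iff (p q : ℕ) :
    (C.tile a).Move p q ↔ ∃ d ∈ C.trans, (d.2.1 = a ∧ d.1 ≤ p) ∧ q ≤ d.2.2.2 := by
  constructor
  · rintro ⟨c, d, hd, ha, hp, hq, -⟩
    exact ⟨d, hd, ⟨ha, hp⟩, hq⟩
  · rintro ⟨d, hd, ⟨ha, hp⟩, hq⟩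
    exact ⟨1, d, hd, ha, hp, hq, fun _ _ h => absurd h one_ne_zero⟩

theorem bestTarget_eq_some_iff (p q : ℕ) : C.bestTarget a p = some q ↔
    (∃ d ∈ C.trans, (d.2.1 = a ∧ d.1 ≤ p) ∧ d.2.2.2 = q) ∧
      ∀ d ∈ C.trans, d.2.1 = a ∧ d.1 ≤ p → d.2.2.2 ≤ q := by
  rw [bestTarget, List.max?_eq_some_iff]
  simp only [List.mem_map, List.mem_filter, decide_eq_true_eq, and_assoc, and_imp,
    forall_exists_index]
  refine and_congr_right fun _ => ⟨fun h d hd ha hp => h _ d hd ha hp rfl, ?_⟩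
  rintro h _ d hd ha hp rfl
  exact h d hd ha hp

theorem isTabulatedBy_tile : (C.tile a).IsTabulatedBy (C.bestTarget a) (C.isBuchi a) := by
  refine ⟨fun p q => ?_, fun p q hq => ?_⟩
  · rw [move_tile_iff]
    constructor
    · rintro ⟨d, hd, hdp, hqd⟩
      obtain ⟨q', hq'⟩ : ∃ q', C.bestTarget a p = some q' := by
        rw [← Option.ne_none_iff_exists', bestTarget, Ne, List.max?_eq_none_iff]
        exact List.ne_nil_of_mem (List.mem_map_of_mem (List.mem_filter.mpr ⟨hd, by simpa⟩))
      exact ⟨q', hq', hqd.trans (((C.bestTarget_eq_some_iff a p q').mp hq').2 d hd hdp)⟩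
    · rintro ⟨q', hq', hle⟩
      obtain ⟨⟨d, hd, hdp, rfl⟩, -⟩ := (C.bestTarget_eq_some_iff a p q').mp hq'
      exact ⟨d, hd, hdp, hle⟩
  · have hmax := ((C.bestTarget_eq_some_iff a p q).mp hq).2
    rw [isBuchi, decide_eq_true_iff, hq]
    refine exists_congr fun d => and_congr_right fun hd => and_congr_right fun ha =>
      and_congr_right fun hdp => ?_
    have hdq : some q = some d.2.2.2 ↔ q ≤ d.2.2.2 :=
      Option.some_inj.trans ⟨le_of_eq, (hmax d hd ⟨ha, hdp⟩).antisymm'⟩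
    rw [hdq]
    refine and_congr_right fun hqd => ?_
    have heq : d.2.2.2 = q := (hmax d hd ⟨ha, hdp⟩).antisymm hqd
    simp [heq]

end Tiles

end AutCode

namespace ParityAutomaton

section OfStep

variable {Al S : Type*}

/-- The deterministic automaton with initial state `q₀` and step function `δ`, which gives the
priority and the target of the transition. -/
def ofStep (hi : ℕ) (q₀ : S) (δ : S → Al → ℕ × S) (hδ : ∀ q a, (δ q a).1 ≤ hi) :
    ParityAutomaton Al S where
  lo := 0
  hi := hi
  lo_le_hi := Nat.zero_le _
  initial := {q₀}
  trans := {d | δ d.1 d.2.1 = d.2.2}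
  priority_mem := by
    rintro ⟨q, a, c, q'⟩ (h : δ q a = (c, q'))
    exact ⟨Nat.zero_le _, (congrArg Prod.fst h).symm.trans_le (hδ q a)⟩

variable {hi : ℕ} {q₀ : S} {δ : S → Al → ℕ × S} {hδ : ∀ q a, (δ q a).1 ≤ hi}

theorem isDeterministic_ofStep : (ofStep hi q₀ δ hδ).IsDeterministic :=
  ⟨⟨q₀, rfl⟩, fun q a => ⟨δ q a, rfl, fun _ h => Eq.symm h⟩⟩

theorem mem_language_ofStep_iff {w : ℕ → Al} {s : ℕ → S} (h0 : s 0 = q₀)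
    (hs : ∀ i, s (i + 1) = (δ (s i) (w i)).2) :
    w ∈ (ofStep hi q₀ δ hδ).language ↔ ParityAccepting fun i => (δ (s i) (w i)).1 := by
  constructor
  · rintro ⟨q, c, hq0, hstep, hacc⟩
    have hqs : ∀ i, q i = s i := fun i => by
      induction i with
      | zero => exact Eq.trans hq0 h0.symm
      | succ i ih => rw [hs, ← ih]; exact (congrArg Prod.snd (hstep i)).symm
    convert hacc using 2 with i
    rw [← hqs]
    exact congrArg Prod.fst (hstep i)
  · exact fun hacc => ⟨s, _, h0, fun i => Prod.ext rfl (hs i).symm, hacc⟩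

theorem reach_append_singleton (A : ParityAutomaton Al S) (u : List Al) (a : Al) :
    A.reach (u ++ [a]) = {q' | ∃ q ∈ A.reach u, ∃ c, (q, a, c, q') ∈ A.trans} := by
  rw [reach, List.foldl_append]
  rfl

end OfStep

end ParityAutomaton

namespace OrderedBuchi

variable {Q : Type*} [LinearOrder Q] (A : OrderedBuchi Q)

theorem mem_language_toParity_iff (w : ℕ → A.tiles) :
    w ∈ A.toParity.language ↔ ∃ ρ, Tile.IsBuchiRun (fun i => (w i : Tile Q)) A.initial ρ := by
  have hzero : ∀ c : ℕ → Fin 2, ParityAccepting (fun i => (c i : ℕ)) ↔ ∃ᶠ i in atTop, c i = 0 :=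
    fun c => by
      simpa only [Fin.val_eq_zero_iff] using
        parityAccepting_iff_frequently_eq_zero fun i => Nat.le_of_lt_succ (c i).isLt
  constructor
  · rintro ⟨q, c, h0, hstep, hacc⟩
    choose b hb hmem using hstep
    obtain rfl : c = fun i => (b i : ℕ) := funext hb
    refine ⟨q, h0, fun i => ⟨b i, hmem i⟩, ((hzero b).mp hacc).mono fun i hi => ?_⟩
    exact hi ▸ hmem i
  · rintro ⟨ρ, h0, hstep, hbuchi⟩
    have hletter : ∀ i, ∃ c : Fin 2, (ρ i, c, ρ (i + 1)) ∈ (w i : Tile Q) ∧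
        ((ρ i, 0, ρ (i + 1)) ∈ (w i : Tile Q) → c = 0) := fun i => by
      by_cases h : (ρ i, 0, ρ (i + 1)) ∈ (w i : Tile Q)
      · exact ⟨0, h, fun _ => rfl⟩
      · exact (hstep i).imp fun c hc => ⟨hc, fun h' => absurd h' h⟩
    choose c hc hc0 using hletter
    exact ⟨ρ, fun i => c i, h0, fun i => ⟨c i, rfl, hc i⟩,
      (hzero c).mpr (hbuchi.mono fun i hi => hc0 i hi)⟩

section RecordAutomaton

variable {A} {S : Set (Record Q)} {s₀ : S} {δ : S → A.tiles → ℕ × S} {hi : ℕ}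
  {hhi : ∀ s a, (δ s a).1 ≤ hi}

theorem language_ofStep_of_recordStep (hs₀ : ∀ q, q ∈ s₀.1.toList ↔ q ∈ A.initial)
    (hδ : ∀ s (a : A.tiles), (a : Tile Q).RecordStep s.1.toList (δ s a).2.1.toList (δ s a).1) :
    (ParityAutomaton.ofStep hi s₀ δ hhi).language = A.toParity.language := by
  ext w
  obtain ⟨s, h0, hs⟩ : ∃ s : ℕ → S, s 0 = s₀ ∧ ∀ i, s (i + 1) = (δ (s i) (w i)).2 :=
    ⟨fun i => i.rec s₀ fun i s => (δ s (w i)).2, rfl, fun _ => rfl⟩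
  have hstep : ∀ i, (w i : Tile Q).RecordStep (s i).1.toList (s (i + 1)).1.toList
      (δ (s i) (w i)).1 := fun i => hs i ▸ hδ (s i) (w i)
  have hinitial : {q | q ∈ (s 0).1.toList} = A.initial := Set.ext fun q => by
    rw [h0]
    exact hs₀ q
  rw [ParityAutomaton.mem_language_ofStep_iff h0 hs, mem_language_toParity_iff, ← hinitial]
  exact Tile.parityAccepting_iff_exists_isBuchiRun (r := fun i => (s i).1.toList)
    (fun i => A.tiles_upClosed _ (w i).2) hstep fun i => hhi (s i) (w i)

theorem setOf_mem_eq_reach_of_recordStep (hs₀ : ∀ q, q ∈ s₀.1.toList ↔ q ∈ A.initial)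
    (hδ : ∀ s (a : A.tiles), (a : Tile Q).RecordStep s.1.toList (δ s a).2.1.toList (δ s a).1)
    {u : List A.tiles} {s : S} (hs : s ∈ (ParityAutomaton.ofStep hi s₀ δ hhi).reach u) :
    {q | q ∈ s.1.toList} = A.toParity.reach u := by
  induction u using List.reverseRecOn generalizing s with
  | nil =>
    obtain rfl : s = s₀ := hs
    exact Set.ext hs₀
  | append_singleton u a ih =>
    rw [ParityAutomaton.reach_append_singleton] at hs ⊢
    obtain ⟨s', hs', c, hstep⟩ := hs
    obtain rfl : (δ s' a).2 = s := congrArg Prod.snd hstep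
    rw [← ih hs']
    ext q
    refine ((hδ s' a).mem_iff q).trans (exists_congr fun p => and_congr_right fun _ => ?_)
    exact ⟨fun ⟨c, hc⟩ => ⟨c, c, rfl, hc⟩, fun ⟨_, c, _, hc⟩ => ⟨c, hc⟩⟩

end RecordAutomaton

end OrderedBuchi

section RecordLists

/-- The records over the numbers below `n`, listed by their first entries. -/
def recordLists (n : ℕ) : List (List ℕ) :=
  [] :: (List.range n).flatMap fun m => (List.range m).permutations'.map (List.cons m)

theorem isRecord_cons_iff {m : ℕ} {r : List ℕ} : IsRecord (m :: r) ↔ r.Perm (List.range m) := by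
  constructor
  · rintro ⟨hnodup, hlower, hmax⟩
    obtain ⟨hm, hr⟩ := List.nodup_cons.mp hnodup
    refine (List.perm_ext_iff_of_nodup hr List.nodup_range).mpr fun x => ?_
    rw [List.mem_range]
    constructor
    · exact fun hx => (hmax m rfl x (List.mem_cons_of_mem m hx)).lt_of_ne fun h => hm (h ▸ hx)
    · exact fun hx => List.mem_of_ne_of_mem hx.ne (hlower hx.le List.mem_cons_self)
  · intro h
    have hmem : ∀ x, x ∈ m :: r ↔ x ≤ m := fun x => by
      rw [List.mem_cons, h.mem_iff, List.mem_range, le_iff_eq_or_lt]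
    refine ⟨List.nodup_cons.mpr ⟨?_, h.nodup_iff.mpr List.nodup_range⟩, fun x y hyx hx => ?_, ?_⟩
    · rw [h.mem_iff, List.mem_range]
      exact lt_irrefl m
    · exact (hmem y).mpr (hyx.trans ((hmem x).mp hx))
    · rintro _ ⟨⟩ x hx
      exact (hmem x).mp hx

theorem mem_recordLists_iff {n : ℕ} {r : List ℕ} :
    r ∈ recordLists n ↔ IsRecord r ∧ ∀ x ∈ r, x < n := by
  simp only [recordLists, List.mem_cons, List.mem_flatMap, List.mem_range, List.mem_map,
    List.mem_permutations']
  rcases r with _ | ⟨m, r⟩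
  · refine iff_of_true (Or.inl rfl) ⟨⟨List.nodup_nil, ?_, ?_⟩, ?_⟩ <;> simp [IsLowerSet]
  · rw [isRecord_cons_iff]
    constructor
    · rintro (h | ⟨m', hm', r', hr', h⟩)
      · exact absurd h (List.cons_ne_nil m r)
      · obtain ⟨rfl, rfl⟩ := List.cons.inj h
        refine ⟨hr', List.forall_mem_cons.mpr ⟨hm', fun x hx => ?_⟩⟩
        exact (List.mem_range.mp (hr'.subset hx)).trans hm'
    · rintro ⟨hr, hlt⟩
      exact Or.inr ⟨m, hlt m List.mem_cons_self, r, hr, rfl⟩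

theorem nodup_recordLists (n : ℕ) : (recordLists n).Nodup := by
  rw [recordLists, List.nodup_cons, List.nodup_flatMap]
  refine ⟨by simp, fun m _ => List.Nodup.map List.cons_injective ?_, ?_⟩
  · exact (List.permutations_perm_permutations' _).nodup_iff.mp
      (List.nodup_permutations _ List.nodup_range)
  · refine List.nodup_range.imp fun {m m'} hne => ?_
    simp only [Function.onFun, List.disjoint_left, List.mem_map]
    rintro _ ⟨r, -, rfl⟩ ⟨r', -, h⟩
    exact hne (List.cons.inj h).1.symm

theorem length_recordLists (n : ℕ) :
    (recordLists n).length = 1 + ∑ i ∈ Finset.range n, Nat.factorial i := by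
  rw [recordLists, List.length_cons, List.length_flatMap, add_comm]
  simp only [List.length_map, ← (List.permutations_perm_permutations' _).length_eq,
    List.length_permutations, List.length_range]
  rfl

/-- The number of `r` among the records over the numbers below `n`. A list that is not such a record
gets the number of all of them. -/
def recordIndex (n : ℕ) (r : List ℕ) : ℕ :=
  (recordLists n).findIdx fun r' => decide (r' = r)

end RecordLists

section Numbering

variable {Q : Type*} [LinearOrder Q] {n : ℕ}

theorem isRecord_map_iff {α β : Type*} [LinearOrder α] [LinearOrder β] (φ : α ≤i β) {r : List α} :
    IsRecord (r.map φ) ↔ IsRecord r := by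
  have hmem : ∀ {q}, φ q ∈ r.map φ ↔ q ∈ r := List.mem_map_of_injective φ.injective
  have hhead : ∀ m, m ∈ (r.map φ).head? ↔ ∃ q ∈ r.head?, φ q = m := fun m => by
    rw [List.head?_map, Option.mem_map]
  constructor
  · rintro ⟨hnodup, hlower, hmax⟩
    refine ⟨hnodup.of_map φ, fun q q' hle hq => ?_, fun m hm q hq => ?_⟩
    · exact hmem.mp (hlower (φ.le_iff_le.mpr hle) (hmem.mpr hq))
    · exact φ.le_iff_le.mp (hmax (φ m) ((hhead _).mpr ⟨m, hm, rfl⟩) (φ q) (hmem.mpr hq))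
  · rintro ⟨hnodup, hlower, hmax⟩
    refine ⟨hnodup.map φ.injective, ?_, ?_⟩
    · intro x y hle hx
      obtain ⟨q, hq, rfl⟩ := List.mem_map.mp hx
      obtain ⟨q', rfl⟩ := φ.mem_range_of_le hle
      exact hmem.mpr (hlower (φ.le_iff_le.mp hle) hq)
    · intro x hx y hy
      obtain ⟨m, hm, rfl⟩ := (hhead x).mp hx
      obtain ⟨q, hq, rfl⟩ := List.mem_map.mp hy
      exact φ.le_iff_le.mpr (hmax m hm q hq)

/-- The numbers of the states, as an initial segment of the natural numbers. -/
def numbering (e : Q ≃o Fin n) : Q ≤i ℕ where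
  toFun q := e q
  inj' _ _ h := e.injective (Fin.ext h)
  map_rel_iff' := e.lt_iff_lt
  mem_range_of_rel' q x hx := ⟨e.symm ⟨x, lt_trans hx (e q).isLt⟩,
    congrArg Fin.val (e.apply_symm_apply _)⟩

theorem numbering_apply (e : Q ≃o Fin n) (q : Q) : numbering e q = e q :=
  rfl

theorem mem_range_numbering_iff (e : Q ≃o Fin n) {x : ℕ} :
    x ∈ Set.range (numbering e) ↔ x < n := by
  constructor
  · rintro ⟨q, rfl⟩
    exact (e q).isLt
  · exact fun hx => ⟨e.symm ⟨x, hx⟩, by simp [numbering_apply]⟩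

/-- Replacing states by their numbers. -/
noncomputable def recordEquiv (e : Q ≃o Fin n) : Record Q ≃ {r // r ∈ recordLists n} :=
  Equiv.ofBijective
    (fun s => ⟨s.toList.map (numbering e), mem_recordLists_iff.mpr
      ⟨(isRecord_map_iff _).mpr ⟨s.nodup, s.lower, s.head_max⟩, fun x hx => by
        obtain ⟨q, -, rfl⟩ := List.mem_map.mp hx
        exact (e q).isLt⟩⟩) <| by
    constructor
    · rintro ⟨L, _, _, _⟩ ⟨L', _, _, _⟩ h
      obtain rfl : L = L' := (numbering e).injective.list_map (congrArg Subtype.val h)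
      rfl
    · rintro ⟨r, hr⟩
      obtain ⟨hrec, hlt⟩ := mem_recordLists_iff.mp hr
      obtain ⟨L, rfl⟩ : r ∈ Set.range (List.map (numbering e)) := by
        rw [Set.range_list_map]
        exact fun x hx => (mem_range_numbering_iff e).mpr (hlt x hx)
      obtain ⟨h1, h2, h3⟩ := (isRecord_map_iff _).mp hrec
      exact ⟨⟨L, h1, h2, h3⟩, rfl⟩

theorem coe_recordEquiv (e : Q ≃o Fin n) (s : Record Q) :
    (recordEquiv e s : List ℕ) = s.toList.map (numbering e) :=
  rfl

/-- The numbering of the records over `Q`, all of which are states of the deterministic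
automaton. -/
noncomputable def recordNumbering (e : Q ≃o Fin n) :
    (Set.univ : Set (Record Q)) ≃ Fin (recordLists n).length :=
  (Equiv.Set.univ _).trans ((recordEquiv e).trans (nodup_recordLists n).getEquiv.symm)

theorem coe_recordNumbering (e : Q ≃o Fin n) (s : (Set.univ : Set (Record Q))) :
    (recordNumbering e s : ℕ) = recordIndex n (recordEquiv e s) :=
  rfl

end Numbering

theorem Tile.RecordStep.of_map {α β : Type*} [LinearOrder α] [LinearOrder β] {φ : α ≤i β}
    {t : Tile α} {t' : Tile β} (ht : ∀ p c q, (p, c, q) ∈ t ↔ (φ p, c, φ q) ∈ t')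
    (hrange : ∀ p y, t'.Move (φ p) y → y ∈ Set.range φ) {r r' : List α} {c : ℕ}
    (h : t'.RecordStep (r.map φ) (r'.map φ) c) : t.RecordStep r r' c := by
  have hmove : ∀ {p q}, t.Move p q ↔ t'.Move (φ p) (φ q) := exists_congr fun c => ht _ c _
  have hbest : ∀ {p q}, t.IsBestMove p q ↔ t'.IsBestMove (φ p) (φ q) := by
    refine fun {p q} => ⟨fun ⟨hpq, hmax⟩ => ⟨hmove.mp hpq, fun y hy => ?_⟩, fun ⟨hpq, hmax⟩ =>
      ⟨hmove.mpr hpq, fun q' hq' => φ.le_iff_le.mp (hmax (hmove.mp hq'))⟩⟩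
    obtain ⟨q', rfl⟩ := hrange p y hy
    exact φ.le_iff_le.mpr (hmax (hmove.mpr hy))
  have hmem : ∀ {L : List α} {q}, φ q ∈ L.map φ ↔ q ∈ L := List.mem_map_of_injective φ.injective
  have htake : ∀ {L : List α} {j q}, φ q ∈ (L.map φ).take j ↔ q ∈ L.take j := by
    simp only [← List.map_take, hmem, implies_true]
  refine ⟨fun q => ?_, fun j p q hp hpq => ?_, fun k j p q hc hkj hp hpq => ?_, fun j hj => ?_,
    h.pos⟩
  · rw [← hmem, h.mem_iff]
    simp only [List.mem_map, exists_exists_and_eq_and, hmove]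
  · exact htake.mp (h.mem_take j _ _ (htake.mpr hp) (hbest.mp hpq))
  · exact htake.mp (h.mem_take_of_odd k j _ _ hc hkj (htake.mpr hp) (hbest.mp hpq))
  · obtain ⟨x, y, hx, hy, hxy, hbuchi⟩ := h.getElem?_of_le j hj
    rw [List.getElem?_map, Option.map_eq_some_iff] at hx hy
    obtain ⟨p, hp, rfl⟩ := hx
    obtain ⟨q, hq, rfl⟩ := hy
    exact ⟨p, q, hp, hq, hbest.mpr hxy, (ht p 0 q).trans hbuchi⟩

namespace AutCode

/-- The record of all numbers that are at most as large as some entry of `I`, in decreasing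
order. -/
def initialRecord (I : List ℕ) : List ℕ :=
  fillBelow I.max?.toList

theorem toList_max?_le {I : List ℕ} : ∀ m ∈ I.max?.toList.head?, ∀ x ∈ I.max?.toList, x ≤ m := by
  cases I.max? <;> simp

theorem mem_initialRecord_iff {I : List ℕ} {x : ℕ} : x ∈ initialRecord I ↔ ∃ y ∈ I, x ≤ y := by
  rw [initialRecord, mem_fillBelow_iff toList_max?_le]
  simp only [Option.mem_toList, List.max?_eq_some_iff]
  constructor
  · rintro ⟨y, ⟨hy, -⟩, hxy⟩
    exact ⟨y, hy, hxy⟩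
  · rintro ⟨y, hy, hxy⟩
    obtain ⟨m, hm⟩ := Option.ne_none_iff_exists'.mp
      fun h => List.ne_nil_of_mem hy (List.max?_eq_none_iff.mp h)
    have hmax := List.max?_eq_some_iff.mp hm
    exact ⟨m, hmax, hxy.trans (hmax.2 y hy)⟩

theorem isRecord_initialRecord (I : List ℕ) : IsRecord (initialRecord I) :=
  isRecord_fillBelow (by cases I.max? <;> simp) toList_max?_le

/-- The description of the deterministic automaton, whose states are the numbers of the records. -/
def determinize (C : AutCode) : AutCode where
  numLetters := C.numLetters
  numStates := (recordLists C.numStates).length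
  lo := 0
  hi := 2 * C.numStates + 1
  initial := [recordIndex C.numStates (initialRecord C.initial)]
  trans := (recordLists C.numStates).flatMap fun r => (List.range C.numLetters).map fun a =>
    (recordIndex C.numStates r, a, stepPriority (C.bestTarget a) (C.isBuchi a) r,
      recordIndex C.numStates (nextRecord (C.bestTarget a) r))

namespace Describes

variable {Q : Type*} [LinearOrder Q] {A : OrderedBuchi Q} {m n : ℕ} {l : A.tiles ≃ Fin m}
  {e : Q ≃o Fin n} {C : AutCode} (hC : C.Describes A.toParity l e.toEquiv)

include hC

theorem mem_trans_iff {x y : ℕ} {a : A.tiles} {c : ℕ} : (x, (l a : ℕ), c, y) ∈ C.trans ↔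
    ∃ p q, numbering e p = x ∧ numbering e q = y ∧ (p, a, c, q) ∈ A.toParity.trans := by
  obtain ⟨-, -, -, -, -, htrans⟩ := hC
  rw [htrans]
  constructor
  · rintro ⟨⟨p, a', c', q⟩, hd, hx⟩
    simp only [Prod.mk.injEq, Fin.val_inj, l.apply_eq_iff_eq] at hx
    obtain ⟨rfl, rfl, rfl, rfl⟩ := hx
    exact ⟨p, q, rfl, rfl, hd⟩
  · rintro ⟨p, q, rfl, rfl, hd⟩
    exact ⟨_, hd, rfl⟩

theorem mem_tile_iff (a : A.tiles) (p : Q) (c : Fin 2) (q : Q) :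
    (p, c, q) ∈ (a : Tile Q) ↔ (numbering e p, c, numbering e q) ∈ C.tile (l a) := by
  constructor
  · intro hmem
    exact ⟨(_, _, (c : ℕ), _), hC.mem_trans_iff.mpr ⟨p, q, rfl, rfl, c, rfl, hmem⟩, rfl, le_rfl,
      le_rfl, fun _ _ hc => Fin.val_eq_zero_iff.mpr hc⟩
  · rintro ⟨⟨x, _, b, y⟩, hd, rfl, hp, hq, hzero⟩
    obtain ⟨p', q', rfl, rfl, c', rfl, hmem⟩ := hC.mem_trans_iff.mp hd
    refine A.tiles_upClosed a a.2 (p', c', q') (p, c, q)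
      ⟨(numbering e).le_iff_le.mp hp, (numbering e).le_iff_le.mp hq, fun heq => ?_⟩ hmem
    obtain ⟨rfl, rfl⟩ := Prod.mk.inj heq
    have hzero' : c = 0 → (c' : ℕ) = 0 := hzero rfl rfl
    change c' ≤ c
    omega

theorem lt_of_move {a : A.tiles} {x y : ℕ} (h : (C.tile (l a)).Move x y) : y < n := by
  obtain ⟨⟨_, _, _, z⟩, hd, ⟨rfl, -⟩, hyz⟩ := (C.move_tile_iff (l a) x y).mp h
  obtain ⟨-, q, -, rfl, -⟩ := hC.mem_trans_iff.mp hd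
  exact hyz.trans_lt (e q).isLt

theorem nextRecord_mem_recordLists (a : A.tiles) {r : List ℕ} (hr : r ∈ recordLists n) :
    nextRecord (C.bestTarget (l a)) r ∈ recordLists n := by
  have hrec := (mem_recordLists_iff.mp hr).1
  have htab := C.isTabulatedBy_tile (l a)
  refine mem_recordLists_iff.mpr
    ⟨htab.isRecord_nextRecord (C.isUpClosed_tile _) hrec, fun x hx => ?_⟩
  obtain ⟨p, -, hpx⟩ :=
    ((htab.recordStep_nextRecord (C.isUpClosed_tile _) hrec).mem_iff x).mp hx
  exact hC.lt_of_move hpx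

theorem mem_initialRecord_iff {x : ℕ} : x ∈ initialRecord C.initial ↔
    ∃ q ∈ A.initial, numbering e q = x := by
  obtain ⟨-, -, -, -, hinitial, -⟩ := hC
  rw [AutCode.mem_initialRecord_iff]
  constructor
  · rintro ⟨y, hy, hxy⟩
    obtain ⟨q, hq, rfl⟩ := (hinitial y).mp hy
    obtain ⟨q', rfl⟩ := (numbering e).mem_range_of_le hxy
    exact ⟨q', A.initial_lower ((numbering e).le_iff_le.mp hxy) hq, rfl⟩
  · rintro ⟨q, hq, rfl⟩
    exact ⟨_, (hinitial _).mpr ⟨q, hq, rfl⟩, le_rfl⟩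

theorem initialRecord_mem_recordLists : initialRecord C.initial ∈ recordLists n := by
  refine mem_recordLists_iff.mpr ⟨isRecord_initialRecord _, fun x hx => ?_⟩
  obtain ⟨q, -, rfl⟩ := hC.mem_initialRecord_iff.mp hx
  exact (e q).isLt

/-- The initial state of the record automaton. -/
noncomputable def initialState : (Set.univ : Set (Record Q)) :=
  ⟨(recordEquiv e).symm ⟨_, hC.initialRecord_mem_recordLists⟩, trivial⟩

/-- The priority and the target of the transition of the record automaton. -/
noncomputable def step (s : (Set.univ : Set (Record Q))) (a : A.tiles) :
    ℕ × (Set.univ : Set (Record Q)) :=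
  (stepPriority (C.bestTarget (l a)) (C.isBuchi (l a)) (recordEquiv e s),
    ⟨(recordEquiv e).symm ⟨_, hC.nextRecord_mem_recordLists a (recordEquiv e s).2⟩, trivial⟩)

theorem coe_recordEquiv_initialState :
    (recordEquiv e hC.initialState : List ℕ) = initialRecord C.initial := by
  rw [initialState, Equiv.apply_symm_apply]

theorem coe_recordEquiv_step (s : (Set.univ : Set (Record Q))) (a : A.tiles) :
    (recordEquiv e (hC.step s a).2 : List ℕ) =
      nextRecord (C.bestTarget (l a)) (recordEquiv e s) := by
  rw [step, Equiv.apply_symm_apply]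

theorem step_fst_le (s : (Set.univ : Set (Record Q))) (a : A.tiles) :
    (hC.step s a).1 ≤ 2 * n + 1 := by
  obtain ⟨hrec, hlt⟩ := mem_recordLists_iff.mp (recordEquiv e s).2
  have hlen : (recordEquiv e s : List ℕ).length ≤ n := by
    have hsub := hrec.nodup.subperm fun x hx => List.mem_range.mpr (hlt x hx)
    exact hsub.length_le.trans_eq List.length_range
  exact (stepPriority_le _ _ _).trans (by omega)

/-- The deterministic automaton on the records over `Q` that `C.determinize` describes. -/
noncomputable def recordAutomaton :
    ParityAutomaton A.tiles (Set.univ : Set (Record Q)) :=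
  .ofStep (2 * n + 1) hC.initialState hC.step hC.step_fst_le

theorem mem_initialState_iff (q : Q) : q ∈ hC.initialState.1.toList ↔ q ∈ A.initial := by
  rw [← List.mem_map_of_injective (f := numbering e) (numbering e).injective, ← coe_recordEquiv,
    coe_recordEquiv_initialState, hC.mem_initialRecord_iff]
  simp only [(numbering e).inj, exists_eq_right]

theorem recordStep_step (s : (Set.univ : Set (Record Q))) (a : A.tiles) :
    (a : Tile Q).RecordStep s.1.toList (hC.step s a).2.1.toList (hC.step s a).1 := by
  refine Tile.RecordStep.of_map (hC.mem_tile_iff a)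
    (fun p y hy => (mem_range_numbering_iff e).mpr (hC.lt_of_move hy)) ?_
  rw [← coe_recordEquiv, ← coe_recordEquiv, coe_recordEquiv_step]
  exact (C.isTabulatedBy_tile (l a)).recordStep_nextRecord (C.isUpClosed_tile _)
    (mem_recordLists_iff.mp (recordEquiv e s).2).1

theorem language_recordAutomaton : hC.recordAutomaton.language = A.toParity.language :=
  OrderedBuchi.language_ofStep_of_recordStep hC.mem_initialState_iff hC.recordStep_step

theorem setOf_mem_eq_reach {u : List A.tiles} {s : (Set.univ : Set (Record Q))}
    (hs : s ∈ hC.recordAutomaton.reach u) : {q | q ∈ s.1.toList} = A.toParity.reach u :=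
  OrderedBuchi.setOf_mem_eq_reach_of_recordStep hC.mem_initialState_iff hC.recordStep_step hs

theorem describes_recordAutomaton :
    C.determinize.Describes hC.recordAutomaton l (recordNumbering e) := by
  obtain rfl : C.numLetters = m := hC.1
  obtain rfl : C.numStates = n := hC.2.1
  have htrans : ∀ (s : (Set.univ : Set (Record Q))) (a : A.tiles),
      (recordIndex C.numStates (recordEquiv e s), (l a : ℕ),
        stepPriority (C.bestTarget (l a)) (C.isBuchi (l a)) (recordEquiv e s),
        recordIndex C.numStates (nextRecord (C.bestTarget (l a)) (recordEquiv e s))) =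
      ((recordNumbering e s : ℕ), (l a : ℕ), (hC.step s a).1,
        (recordNumbering e (hC.step s a).2 : ℕ)) := fun s a => by
    rw [coe_recordNumbering, coe_recordNumbering, hC.coe_recordEquiv_step]
    rfl
  refine ⟨rfl, rfl, rfl, rfl, fun x => ?_, fun x => ?_⟩
  · rw [determinize, List.mem_singleton, ← hC.coe_recordEquiv_initialState, ← coe_recordNumbering]
    exact ⟨fun h => ⟨_, rfl, h⟩, fun ⟨_, hs, h⟩ => hs ▸ h⟩
  · simp only [determinize, List.mem_flatMap, List.mem_map, List.mem_range]
    constructor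
    · rintro ⟨r, hr, a, ha, rfl⟩
      obtain ⟨s, hs⟩ := (recordEquiv e).surjective ⟨r, hr⟩
      obtain rfl : (recordEquiv e s : List ℕ) = r := congrArg Subtype.val hs
      obtain ⟨a, rfl⟩ : ∃ a', (l a' : ℕ) = a := ⟨l.symm ⟨a, ha⟩, by rw [l.apply_symm_apply]⟩
      exact ⟨(⟨s, trivial⟩, a, hC.step ⟨s, trivial⟩ a), rfl, htrans ⟨s, trivial⟩ a⟩
    · rintro ⟨⟨s, a, y⟩, hd, rfl⟩
      obtain rfl : hC.step s a = y := hd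
      exact ⟨_, (recordEquiv e s).2, _, (l a).isLt, htrans s a⟩

end Describes

end AutCode

section Primrec

open Primrec

theorem survivors_eq_foldl {Q : Type*} [DecidableEq Q] (best : Q → Option Q) (r : List Q) :
    survivors best r = r.foldl (fun s p => s ++ (best p).toList.filter (· ∉ s)) [] := by
  induction r using List.reverseRecOn with
  | nil => rfl
  | append_singleton r p ih => rw [survivors_append_singleton, List.foldl_concat, ← ih]

variable {α β : Type*} [Primcodable α] [Primcodable β]

theorem primrecRel_list_mem : PrimrecRel fun (b : β) (L : List β) => b ∈ L :=
  (Primrec.eq.exists_mem_list.comp snd fst).of_eq fun _ => by simp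

theorem primrec_filter_notMem [DecidableEq β] :
    Primrec₂ fun L L' : List β => L.filter (· ∉ L') :=
  primrecRel_list_mem.not.listFilter

theorem primrec_max? : Primrec (List.max? : List ℕ → Option ℕ) := by
  refine (list_casesOn .id (const none) (h := fun _ (x : ℕ × List ℕ) =>
    some (x.2.foldl max x.1)) ?_).of_eq fun L => ?_
  · exact option_some.comp (list_foldl (snd.comp snd) (fst.comp snd)
      (nat_max.comp (fst.comp snd) (snd.comp snd)).to₂)
  · cases L <;> rfl

theorem primrec_survivors [DecidableEq β] {best : α → β → Option β} {r : α → List β}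
    (hbest : Primrec₂ best) (hr : Primrec r) : Primrec fun x => survivors (best x) (r x) := by
  simp only [survivors_eq_foldl]
  refine list_foldl hr (const []) (h := fun x (y : List β × β) =>
    y.1 ++ (best x y.2).toList.filter (· ∉ y.1)) ?_
  have hs : Primrec fun z : α × List β × β => z.2.1 := fst.comp snd
  have hp : Primrec fun z : α × List β × β => z.2.2 := snd.comp snd
  exact list_append.comp hs
    (primrec_filter_notMem.comp (optionToList.comp (hbest.comp fst hp)) hs)

theorem primrec_numStable [DecidableEq β] {best : α → β → Option β} {r : α → List β}
    (hbest : Primrec₂ best) (hr : Primrec r) : Primrec fun x => numStable (best x) (r x) := by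
  refine nat_findGreatest (list_length.comp hr) (p := fun x k =>
    (survivors (best x) ((r x).take k)).length = k) (Primrec.eq.comp (list_length.comp ?_) snd)
  exact primrec_survivors (best := fun x : α × ℕ => best x.1)
    (hbest.comp (fst.comp fst) snd) (list_take.comp snd (hr.comp fst))

theorem primrec_stepPriority [DecidableEq β] {best : α → β → Option β} {g : α → β → Bool}
    {r : α → List β} (hbest : Primrec₂ best) (hg : Primrec₂ g) (hr : Primrec r) :
    Primrec fun x => stepPriority (best x) (g x) (r x) :=
  nat_min.comp (nat_double_succ.comp (primrec_numStable hbest hr))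
    (succ.comp (nat_double_succ.comp (list_findIdx hr hg)))

theorem primrec_fillBelow : Primrec fillBelow :=
  list_append.comp .id
    (primrec_filter_notMem.comp (list_reverse.comp (list_range.comp list_headI)) .id)

theorem primrec_nextRecord {best : α → ℕ → Option ℕ} {r : α → List ℕ} (hbest : Primrec₂ best)
    (hr : Primrec r) : Primrec fun x => nextRecord (best x) (r x) :=
  primrec_fillBelow.comp (primrec_survivors hbest hr)

theorem primrec_permutations'Aux :
    Primrec₂ (List.permutations'Aux : β → List β → List (List β)) := by
  refine (list_rec snd (list_cons.comp (list_cons.comp fst (const [])) (const []))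
    (h := fun (x : β × List β) (y : β × List β × List (List β)) =>
      (x.1 :: y.1 :: y.2.1) :: y.2.2.map (List.cons y.1)) ?_).of_eq ?_
  · refine list_cons.comp (list_cons.comp (fst.comp fst)
      (list_cons.comp (fst.comp snd) (fst.comp (snd.comp snd)))) ?_
    exact list_map (snd.comp (snd.comp snd)) (list_cons.comp (fst.comp (snd.comp fst)) snd)
  · rintro ⟨b, L⟩
    induction L with
    | nil => rfl
    | cons b' L ih => exact congrArg _ (congrArg _ ih)

theorem primrec_permutations' : Primrec (List.permutations' : List β → List (List β)) := by
  refine (list_rec .id (const [[]]) (h := fun _ (y : β × List β × List (List β)) =>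
    y.2.2.flatMap (List.permutations'Aux y.1)) ?_).of_eq fun L => ?_
  · exact list_flatMap (snd.comp (snd.comp snd))
      (primrec_permutations'Aux.comp (fst.comp (snd.comp fst)) snd)
  · induction L with
    | nil => rfl
    | cons b L ih => exact congrArg (List.flatMap (List.permutations'Aux b)) ih

theorem primrec_recordLists : Primrec recordLists :=
  list_cons.comp (const []) (list_flatMap list_range
    (list_map (primrec_permutations'.comp (list_range.comp snd))
      (list_cons.comp (snd.comp fst) snd)))

theorem primrec_recordIndex : Primrec₂ recordIndex :=
  list_findIdx (primrec_recordLists.comp fst) (Primrec.eq.decide.comp snd (snd.comp fst))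

namespace AutCode

theorem primrec_equivProd : Primrec equivProd :=
  of_equiv

theorem primrec_numLetters : Primrec numLetters :=
  (fst.comp primrec_equivProd).of_eq fun _ => rfl

theorem primrec_numStates : Primrec numStates :=
  (fst.comp (snd.comp primrec_equivProd)).of_eq fun _ => rfl

theorem primrec_initial : Primrec initial :=
  (fst.comp (snd.comp (snd.comp (snd.comp (snd.comp primrec_equivProd))))).of_eq fun _ => rfl

theorem primrec_trans : Primrec trans :=
  (snd.comp (snd.comp (snd.comp (snd.comp (snd.comp primrec_equivProd))))).of_eq fun _ => rfl

theorem primrecRel_letter_source : PrimrecRel fun (d : ℕ × ℕ × ℕ × ℕ) (y : ℕ × ℕ) =>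
    d.2.1 = y.1 ∧ d.1 ≤ y.2 :=
  (Primrec.eq.comp (fst.comp (snd.comp fst)) (fst.comp snd)).and
    (nat_le.comp (fst.comp fst) (snd.comp snd))

theorem primrec_bestTarget {C : α → AutCode} {a p : α → ℕ} (hC : Primrec C) (ha : Primrec a)
    (hp : Primrec p) : Primrec fun x => (C x).bestTarget (a x) (p x) := by
  have hfilter := primrecRel_letter_source.listFilter.comp (primrec_trans.comp hC) (ha.pair hp)
  exact primrec_max?.comp (list_map hfilter (snd.comp (snd.comp (snd.comp snd))).to₂)

theorem primrec_isBuchi {C : α → AutCode} {a p : α → ℕ} (hC : Primrec C) (ha : Primrec a)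
    (hp : Primrec p) : Primrec fun x => (C x).isBuchi (a x) (p x) := by
  have hrel : PrimrecRel fun (d : ℕ × ℕ × ℕ × ℕ) (x : α) =>
      d.2.1 = a x ∧ d.1 ≤ p x ∧ (C x).bestTarget (a x) (p x) = some d.2.2.2 ∧
        (d.1 = p x → d.2.2.1 = 0) := by
    have hd : Primrec fun y : (ℕ × ℕ × ℕ × ℕ) × α => y.1 := fst
    have hsource : Primrec fun y : (ℕ × ℕ × ℕ × ℕ) × α => y.1.1 := fst.comp hd
    refine PrimrecPred.and (Primrec.eq.comp (fst.comp (snd.comp hd)) (ha.comp snd))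
      (PrimrecPred.and (nat_le.comp hsource (hp.comp snd)) (PrimrecPred.and
        (Primrec.eq.comp ((primrec_bestTarget hC ha hp).comp snd)
          (option_some.comp (snd.comp (snd.comp (snd.comp hd))))) ?_))
    simp only [imp_iff_not_or]
    exact (Primrec.eq.comp hsource (hp.comp snd)).not.or
      (Primrec.eq.comp (fst.comp (snd.comp (snd.comp hd))) (const 0))
  exact (hrel.exists_mem_list.comp (primrec_trans.comp hC) .id).decide

theorem primrec_determinize : Primrec determinize := by
  have hinitial : Primrec fun C : AutCode =>
      [recordIndex C.numStates (initialRecord C.initial)] := by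
    have hrecord := primrec_fillBelow.comp (optionToList.comp (primrec_max?.comp primrec_initial))
    exact list_cons.comp (primrec_recordIndex.comp primrec_numStates hrecord) (const [])
  have htrans : Primrec fun C : AutCode => C.determinize.trans := by
    refine list_flatMap (primrec_recordLists.comp primrec_numStates)
      (list_map (list_range.comp (primrec_numLetters.comp fst)) ?_)
    have hC : Primrec fun y : (AutCode × List ℕ) × ℕ => y.1.1 := fst.comp fst
    have hr : Primrec fun y : (AutCode × List ℕ) × ℕ => y.1.2 := snd.comp fst
    have ha : Primrec fun y : (AutCode × List ℕ) × ℕ => y.2 := snd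
    have hbest : Primrec₂ fun (y : (AutCode × List ℕ) × ℕ) p => y.1.1.bestTarget y.2 p :=
      primrec_bestTarget (hC.comp fst) (ha.comp fst) snd
    have hbuchi : Primrec₂ fun (y : (AutCode × List ℕ) × ℕ) p => y.1.1.isBuchi y.2 p :=
      primrec_isBuchi (hC.comp fst) (ha.comp fst) snd
    have hindex {f : (AutCode × List ℕ) × ℕ → List ℕ} (hf : Primrec f) :
        Primrec fun y => recordIndex y.1.1.numStates (f y) :=
      primrec_recordIndex.comp (primrec_numStates.comp hC) hf
    exact (hindex hr).pair (ha.pair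
      ((primrec_stepPriority hbest hbuchi hr).pair (hindex (primrec_nextRecord hbest hr))))
  exact (of_equiv_iff equivProd).mp <| primrec_numLetters.pair <|
    (list_length.comp (primrec_recordLists.comp primrec_numStates)).pair <| (const 0).pair <|
      (nat_double_succ.comp primrec_numStates).pair <| hinitial.pair htrans

end AutCode

end Primrec

theorem mainTheorem3 :
    ∃ F : AutCode → AutCode, Computable F ∧
      ∀ (Q : Type*) [Finite Q] [LinearOrder Q] (A : OrderedBuchi Q) (m n : ℕ)
        (l : A.tiles ≃ Fin m) (e : Q ≃o Fin n) (C : AutCode),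
        C.Describes A.toParity l e.toEquiv →
        ∃ (S : Set (Record Q)) (D : ParityAutomaton A.tiles S) (k : ℕ) (σ : S ≃ Fin k),
          (F C).Describes D l σ ∧
          D.IsDeterministic ∧
          D.language = A.toParity.language ∧
          k ≤ 1 + ∑ i ∈ Finset.range (Nat.card Q), Nat.factorial i ∧
          (∀ (u : List A.tiles) (s : S), s ∈ D.reach u →
            {q | q ∈ s.1.toList} = A.toParity.reach u) := by
  refine ⟨AutCode.determinize, AutCode.primrec_determinize.to_comp, fun Q _ _ A m n l e C hC =>
    ⟨Set.univ, hC.recordAutomaton, _, recordNumbering e, hC.describes_recordAutomaton,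
      ParityAutomaton.isDeterministic_ofStep, hC.language_recordAutomaton, ?_,
      fun u s hs => hC.setOf_mem_eq_reach hs⟩⟩
  rw [Nat.card_congr e.toEquiv, Nat.card_fin, length_recordLists]
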